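/- Let $\beta\ge 1$, and let $\boldsymbol\mu_\beta=\bigotimes_{j\ge1}\mathcal N_\beta(0,1)$ be the product measure on $\mathbb R^{\mathbb N}$ of the univariate $\beta$-Gaussian distributions with density $\varphi_\beta(y)=\frac{1}{2\beta^{1/\beta}\Gamma(1+1/\beta)}e^{-|y|^\beta/\beta}$. Let $\boldsymbol\alpha=(\alpha_j)_{j\ge1}\in\ell^1(\mathbb N)$ with $\alpha_j\ge0$ for all $j$, where in the case $\beta=1$ we assume in addition that $\alpha_j<1$ for all $j$, and let $U_{\boldsymbol\alpha}=\{\boldsymbol y\in\mathbb R^{\mathbb N}:\sum_{j\ge1}\alpha_j|y_j|<\infty\}$ (a set of full $\boldsymbol\mu_\beta$-measure). Let $X$ be a separable real Banach space with dual $X'$, let $g:U_{\boldsymbol\alpha}\to X$, and put $g_s(\boldsymbol y)=g(y_1,\dots,y_s,0,0,\dots)$. Suppose: (A1) For $\boldsymbol\mu_\beta$-almost every $\boldsymbol y\in U_{\boldsymbol\alpha}$, $\|g(\boldsymbol y)-g_s(\boldsymbol y)\|_X\to0$ as $s\to\infty$. (A2) There are a number $p\in(0,1)$, a sequence $(\Theta_n)_{n\ge0}$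 of nonnegative numbers and a sequence $\boldsymbol b=(b_j)_{j\ge1}\in\ell^p(\mathbb N)$ with $b_1\ge b_2\ge\cdots\ge0$ such that, with $k=\lceil\frac1{1-p}\rceil$, the map $g$ is continuously differentiable up to order $k+1$ (it suffices that for every $\boldsymbol y\in U_{\boldsymbol\alpha}$ and every finite set of variables, $g$ is $C^{k+1}$ as a function of these variables, the others being fixed at $\boldsymbol y$), and $$\|\partial^{\boldsymbol\nu}g(\boldsymbol y)\|_X\le\Theta_{|\boldsymbol\nu|}\prod_{j\ge1}b_j^{\nu_j}\prod_{j\ge1}e^{\alpha_j|y_j|}$$ for all $\boldsymbol y\in U_{\boldsymbol\alpha}$ and all multi-indices $\boldsymbol\nu\in\mathbb N_0^{\mathbb N}$ with $|\boldsymbol\nu|=\sum_j\nu_j\le k+1$ (where $0^0=1$). Then there is a constant $C>0$, independent of $s$ and of $G$, such that for all integers $s\ge1$ the function $g-g_s$ is Bochner integrable with respect to $\boldsymbol\mu_\beta$, $$\left\|\int_{\mathbb R^{\mathbb N}}(g(\boldsymbol y)-g_s(\boldsymbol y))\,\boldsymbol\mu_\beta(\mathrm d\boldsymbol y)\right\|_X\le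 C\,s^{-\frac2p+1},$$ and, for every $G\in X'$, $$\left|\int_{\mathbb R^{\mathbb N}}G(g(\boldsymbol y)-g_s(\boldsymbol y))\,\boldsymbol\mu_\beta(\mathrm d\boldsymbol y)\right|\le C\,\|G\|_{X'}\,s^{-\frac2p+1}.$$ -/

import Mathlib

open MeasureTheory Filter Topology

/-- The weighted sequence space `U_α = {y ∈ ℝ^ℕ : ∑ α_j |y_j| < ∞}` (coordinates indexed from `0`). -/
def USet (α : ℕ → ℝ) : Set (ℕ → ℝ) :=
  {y | Summable fun j => α j * |y j|}

/-- The truncation `(y_{≤ s}, 0)`: the first `s` coordinates are kept, all others are set to zero. -/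
def truncSeq (s : ℕ) (y : ℕ → ℝ) : ℕ → ℝ :=
  fun j => if j < s then y j else 0

/-- The density `φ_β` of the univariate `β`-Gaussian distribution `N_β(0,1)`. -/
noncomputable def betaGaussianDensity (β y : ℝ) : ℝ :=
  1 / (2 * β ^ (1 / β) * Real.Gamma (1 + 1 / β)) * Real.exp (-(|y| ^ β / β))

/-- The univariate `β`-Gaussian distribution `N_β(0,1)`. -/
noncomputable def betaGaussian (β : ℝ) : Measure ℝ :=
  volume.withDensity fun y => ENNReal.ofReal (betaGaussianDensity β y)

/-- `N_β(0,1)` is a probability measure, so that its infinite product makes sense. -/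
theorem isProbabilityMeasure_betaGaussian {β : ℝ} (hβ : 0 < β) :
    IsProbabilityMeasure (betaGaussian β) := by
  have hb : (0 : ℝ) < β⁻¹ := inv_pos.mpr hβ
  have hG : 0 < Real.Gamma (1 + 1 / β) := Real.Gamma_pos_of_pos (by positivity)
  have hI : ∫ x : ℝ, Real.exp (-(|x| ^ β / β)) = 2 * β ^ (1 / β) * Real.Gamma (1 + 1 / β) := by
    have h1 := integral_comp_abs (f := fun x : ℝ => Real.exp (-(x ^ β / β)))
    have h2 := integral_exp_neg_mul_rpow hβ hb
    have h3 : ∀ x : ℝ, -β⁻¹ * x ^ β = -(x ^ β / β) := fun x => by ring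
    simp only [h3] at h2
    rw [h1, h2, Real.inv_rpow hβ.le, ← Real.rpow_neg hβ.le]
    rw [show -(-1 / β) = 1 / β by ring, show 1 / β + 1 = 1 + 1 / β by ring]
    ring
  have hne : ∫ x : ℝ, Real.exp (-(|x| ^ β / β)) ≠ 0 := by
    rw [hI]; positivity
  have hint : Integrable fun x : ℝ => Real.exp (-(|x| ^ β / β)) := by
    by_contra h
    exact hne (integral_undef h)
  constructor
  rw [betaGaussian, withDensity_apply _ MeasurableSet.univ, Measure.restrict_univ,
    ← ofReal_integral_eq_lintegral_ofReal]
  · simp only [betaGaussianDensity]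
    rw [integral_const_mul, hI, one_div, inv_mul_cancel₀ (by positivity), ENNReal.ofReal_one]
  · exact hint.const_mul _
  · refine Filter.Eventually.of_forall fun x => ?_
    simp only [betaGaussianDensity, Pi.zero_apply]
    positivity

/-- The product measure `μ_β = ⨂_{j} N_β(0,1)` on `ℝ^ℕ`. -/
noncomputable def betaGaussianProduct (β : ℝ) : Measure (ℕ → ℝ) :=
  Measure.infinitePi fun _ : ℕ => betaGaussian β

section Derivatives

/-- The partial derivative `∂_j f` of a function of infinitely many real variables. -/
noncomputable def partialDeriv {X : Type*} [NormedAddCommGroup X] [NormedSpace ℝ X]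
    (j : ℕ) (f : (ℕ → ℝ) → X) : (ℕ → ℝ) → X :=
  fun y => deriv (fun t : ℝ => f (Function.update y j t)) (y j)

/-- The mixed partial derivative `∂^ν f` for a finitely supported multi-index `ν`: the operators
`∂_j` (each `j` occurring `ν_j` times) are applied to `f` one after the other. -/
noncomputable def mixedPartial {X : Type*} [NormedAddCommGroup X] [NormedSpace ℝ X]
    (ν : ℕ →₀ ℕ) (f : (ℕ → ℝ) → X) : (ℕ → ℝ) → X :=
  ((Finsupp.toMultiset ν).sort (· ≤ ·)).foldr partialDeriv f

/-- `f` as a function of the finitely many coordinates in `J`, the others being frozen at `y`. -/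
def coordSlice {X : Type*} (f : (ℕ → ℝ) → X) (y : ℕ → ℝ) (J : Finset ℕ) : (J → ℝ) → X :=
  fun t => f fun j => if h : j ∈ J then t ⟨j, h⟩ else y j

/-- `f` is `n` times continuously differentiable on `U` in every finite set of its variables.
(Used for sets `U` which are stable under changing finitely many coordinates.) This is implied by
`n`-fold continuous differentiability with respect to any vector topology on `U`, and by the
existence and continuity on `U` of all partial derivatives of order at most `n`. -/
def ContDiffFinitary {X : Type*} [NormedAddCommGroup X] [NormedSpace ℝ X]
    (n : ℕ) (f : (ℕ → ℝ) → X) (U : Set (ℕ → ℝ)) : Prop :=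
  ∀ y ∈ U, ∀ J : Finset ℕ, ContDiff ℝ (n : WithTop ℕ∞) (coordSlice f y J)

end Derivatives

/-! ### Exponential moments of the `β`-Gaussian distribution -/

/-! The error is telescoped into the increments `g (truncSeq (j + 1) y) - g (truncSeq j y)`, `j ≥
s`. The measure is invariant under `y j ↦ -y j`, so each increment has half the expectation of a
second difference in the variable `y j` at `0`: the first-order term cancels
(`norm_truncSeq_reflect_le`, `norm_integral_truncSeq_succ_sub_le`). Hence the increment is of size
`b j ^ 2`, with a constant uniform in `j`, since the weights `exp (α i * |y i|)` have expectations
at most `exp (c * α i)` and `α` is summable (`lintegral_sq_mul_exp_sum_le`). Monotonicity and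
`p`-summability of `b` turn the tail of `∑ b j ^ 2` into the rate (`sum_Ico_sq_le_of_antitone`).
Only `g` itself and its pure second derivatives are estimated. Domination by `exp (∑' i, α i * |y
i|)` lets the telescoped sum pass to the limit, and functionals commute with the Bochner integral.
-/

theorem exists_exponent_le_sub_mul_abs {β a : ℝ} (hβ : 1 ≤ β) (ha : β = 1 → a < 1) :
    ∃ C δ : ℝ, 0 < δ ∧ ∀ y : ℝ, a * |y| - |y| ^ β / β ≤ C - δ * |y| := by
  rcases hβ.eq_or_lt with h | h
  · subst h
    refine ⟨0, 1 - a, sub_pos.2 (ha rfl), fun y => ?_⟩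
    rw [Real.rpow_one]
    linarith
  -- Young's inequality is applied to `|y| * (|a| + 1)`; the extra `1` leaves the decay `δ = 1`.
  · refine ⟨(|a| + 1) ^ (Real.conjExponent β) / Real.conjExponent β, 1, one_pos, fun y => ?_⟩
    have := Real.young_inequality_of_nonneg (abs_nonneg y) (by positivity : 0 ≤ |a| + 1)
      (Real.HolderConjugate.conjExponent h)
    nlinarith [le_abs_self a, abs_nonneg y]

theorem integrable_exp_neg_mul_abs {δ : ℝ} (hδ : 0 < δ) :
    Integrable fun y : ℝ => Real.exp (-δ * |y|) := by
  -- A non-integrable function would have integral `0`, but the value here is `2 / δ`.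
  by_contra h
  have h0 := integral_undef h
  rw [integral_comp_abs (f := fun y : ℝ => Real.exp (-δ * y)),
    integral_exp_mul_Ioi (neg_lt_zero.2 hδ)] at h0
  simp [hδ.ne'] at h0

theorem measurable_betaGaussianDensity (β : ℝ) : Measurable (betaGaussianDensity β) := by
  unfold betaGaussianDensity
  fun_prop

theorem betaGaussianDensity_nonneg {β : ℝ} (hβ : 0 < β) (y : ℝ) : 0 ≤ betaGaussianDensity β y := by
  have : 0 < Real.Gamma (1 + 1 / β) := Real.Gamma_pos_of_pos (by positivity)
  unfold betaGaussianDensity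
  positivity

theorem integrable_exp_mul_abs_betaGaussian {β a : ℝ} (hβ : 1 ≤ β) (ha : β = 1 → a < 1) :
    Integrable (fun y => Real.exp (a * |y|)) (betaGaussian β) := by
  have hβ0 : 0 < β := by linarith
  obtain ⟨C, δ, hδ, hC⟩ := exists_exponent_le_sub_mul_abs hβ ha
  have hm := measurable_betaGaussianDensity β
  rw [betaGaussian, integrable_withDensity_iff_integrable_smul' (by fun_prop) (by simp)]
  have hG : 0 < Real.Gamma (1 + 1 / β) := Real.Gamma_pos_of_pos (by positivity)
  refine ((integrable_exp_neg_mul_abs hδ).const_mul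
    (1 / (2 * β ^ (1 / β) * Real.Gamma (1 + 1 / β)) * Real.exp C)).mono'
    (by fun_prop) (Eventually.of_forall fun y => ?_)
  rw [ENNReal.toReal_ofReal (betaGaussianDensity_nonneg hβ0 y), smul_eq_mul, norm_mul,
    Real.norm_of_nonneg (betaGaussianDensity_nonneg hβ0 y), Real.norm_of_nonneg (by positivity),
    betaGaussianDensity, mul_assoc (1 / _), mul_assoc (1 / _), ← Real.exp_add, ← Real.exp_add]
  gcongr _ * Real.exp ?_
  linarith [hC y]

theorem map_neg_betaGaussian (β : ℝ) : (betaGaussian β).map (fun y => -y) = betaGaussian β := by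
  have hm : Measurable (fun y => ENNReal.ofReal (betaGaussianDensity β y)) :=
    (measurable_betaGaussianDensity β).ennreal_ofReal
  ext s hs
  rw [Measure.map_apply measurable_neg hs, betaGaussian, withDensity_apply _ (measurable_neg hs),
    withDensity_apply _ hs,
    ← (Measure.measurePreserving_neg (volume : Measure ℝ)).setLIntegral_comp_preimage hs hm]
  simp [betaGaussianDensity]

/-! ### Exponential moments of products of symmetric measures -/

theorem sq_mul_exp_mul_abs_le {a a' : ℝ} (h : a < a') (y : ℝ) :
    y ^ 2 * Real.exp (a * |y|) ≤ 2 / (a' - a) ^ 2 * Real.exp (a' * |y|) := by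
  have hd : 0 < a' - a := sub_pos.2 h
  have h1 := Real.quadratic_le_exp_of_nonneg (x := (a' - a) * |y|) (by positivity)
  have h2 : y ^ 2 ≤ 2 / (a' - a) ^ 2 * Real.exp ((a' - a) * |y|) := by
    rw [div_mul_eq_mul_div, le_div_iff₀ (by positivity), ← sq_abs y]
    nlinarith [mul_nonneg hd.le (abs_nonneg y)]
  calc y ^ 2 * Real.exp (a * |y|)
      ≤ 2 / (a' - a) ^ 2 * Real.exp ((a' - a) * |y|) * Real.exp (a * |y|) := by gcongr
    _ = _ := by rw [mul_assoc, ← Real.exp_add]; ring_nf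

theorem integrable_sq_mul_exp_mul_abs {γ : Measure ℝ} {a a' : ℝ} (h : a < a')
    (hi : Integrable (fun y => Real.exp (a' * |y|)) γ) :
    Integrable (fun y => y ^ 2 * Real.exp (a * |y|)) γ := by
  refine (hi.const_mul (2 / (a' - a) ^ 2)).mono' (by fun_prop) (Eventually.of_forall fun y => ?_)
  rw [Real.norm_of_nonneg (by positivity)]
  exact sq_mul_exp_mul_abs_le h y

theorem integrable_abs_mul_exp_mul_abs {γ : Measure ℝ} {a a' : ℝ} (h : a < a')
    (hi : Integrable (fun y => Real.exp (a' * |y|)) γ) :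
    Integrable (fun y => |y| * Real.exp (a * |y|)) γ := by
  refine (hi.add (integrable_sq_mul_exp_mul_abs h hi)).mono' (by fun_prop)
    (Eventually.of_forall fun y => ?_)
  rw [Real.norm_of_nonneg (by positivity), Pi.add_apply]
  have h1 : Real.exp (a * |y|) ≤ Real.exp (a' * |y|) := by gcongr
  have h2 : |y| ≤ 1 + y ^ 2 := by rw [← sq_abs y]; nlinarith [sq_nonneg (|y| - 1)]
  nlinarith [mul_le_mul_of_nonneg_right h2 (Real.exp_pos (a * |y|)).le]

/-- Integrate `exp x ≤ 1 + x * exp x`, then use `1 + x ≤ exp x`. Because the exponent is linear in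
`c`, products over coordinates stay bounded when the `c`'s are summable. -/
theorem lintegral_exp_mul_abs_le {γ : Measure ℝ} [IsProbabilityMeasure γ] {a c : ℝ}
    (hi : Integrable (fun y => |y| * Real.exp (a * |y|)) γ) (hc : 0 ≤ c) (hca : c ≤ a) :
    ∫⁻ y, ENNReal.ofReal (Real.exp (c * |y|)) ∂γ ≤
      ENNReal.ofReal (Real.exp (c * ∫ y, |y| * Real.exp (a * |y|) ∂γ)) := by
  have hp : ∀ y : ℝ, Real.exp (c * |y|) ≤ 1 + c * (|y| * Real.exp (a * |y|)) := fun y => by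
    have h1 : Real.exp (c * |y|) ≤ Real.exp (a * |y|) := by gcongr
    have h2 := Real.add_one_le_exp (-(c * |y|))
    have h3 : Real.exp (c * |y|) * Real.exp (-(c * |y|)) = 1 := by simp [← Real.exp_add]
    have h4 : 0 ≤ c * |y| := by positivity
    nlinarith [Real.exp_pos (c * |y|), mul_le_mul_of_nonneg_left h1 h4]
  have hint : Integrable (fun y => 1 + c * (|y| * Real.exp (a * |y|))) γ :=
    (integrable_const _).add (hi.const_mul c)
  calc ∫⁻ y, ENNReal.ofReal (Real.exp (c * |y|)) ∂γ
      ≤ ∫⁻ y, ENNReal.ofReal (1 + c * (|y| * Real.exp (a * |y|))) ∂γ :=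
        lintegral_mono fun y => ENNReal.ofReal_le_ofReal (hp y)
    _ = ENNReal.ofReal (1 + c * ∫ y, |y| * Real.exp (a * |y|) ∂γ) := by
        rw [← ofReal_integral_eq_lintegral_ofReal hint
          (Eventually.of_forall fun y => by simp only [Pi.zero_apply]; positivity),
          integral_add (integrable_const _) (hi.const_mul c), integral_const_mul]
        simp
    _ ≤ _ := by
        rw [add_comm]
        exact ENNReal.ofReal_le_ofReal (Real.add_one_le_exp _)

theorem lintegral_infinitePi_prod {ι : Type*} (γ : Measure ℝ) [IsProbabilityMeasure γ]
    (s : Finset ι) {f : ι → ℝ → ENNReal} (hf : ∀ i, Measurable (f i)) :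
    ∫⁻ y, ∏ i ∈ s, f i (y i) ∂(Measure.infinitePi fun _ : ι => γ) =
      ∏ i ∈ s, ∫⁻ x, f i x ∂γ := by
  rw [ProbabilityTheory.lintegral_prod_eq_prod_lintegral_of_indepFun s
    (fun i (y : ι → ℝ) => f i (y i)) (ProbabilityTheory.iIndepFun_infinitePi hf)
    (fun i => (hf i).comp (measurable_pi_apply i))]
  refine Finset.prod_congr rfl fun i _ => ?_
  exact (measurePreserving_eval_infinitePi (fun _ : ι => γ) i).lintegral_comp (hf i)

section Product

variable {γ : Measure ℝ} [IsProbabilityMeasure γ] {α : ℕ → ℝ} {a : ℝ}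

theorem prod_lintegral_exp_mul_abs_le (hα : ∀ j, 0 ≤ α j) (hs : Summable α) (hαa : ∀ j, α j ≤ a)
    (hi : Integrable (fun y => |y| * Real.exp (a * |y|)) γ) (s : Finset ℕ) :
    ∏ i ∈ s, ∫⁻ x, ENNReal.ofReal (Real.exp (α i * |x|)) ∂γ ≤
      ENNReal.ofReal (Real.exp ((∑' i, α i) * ∫ y, |y| * Real.exp (a * |y|) ∂γ)) := by
  calc _ ≤ ∏ i ∈ s, ENNReal.ofReal (Real.exp (α i * ∫ y, |y| * Real.exp (a * |y|) ∂γ)) :=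
        Finset.prod_le_prod' fun i _ => lintegral_exp_mul_abs_le hi (hα i) (hαa i)
    _ = ENNReal.ofReal (Real.exp ((∑ i ∈ s, α i) * ∫ y, |y| * Real.exp (a * |y|) ∂γ)) := by
        rw [← ENNReal.ofReal_prod_of_nonneg (fun _ _ => (Real.exp_pos _).le), ← Real.exp_sum,
          Finset.sum_mul]
    _ ≤ _ := by
        have : 0 ≤ ∫ y, |y| * Real.exp (a * |y|) ∂γ := integral_nonneg fun y => by positivity
        gcongr
        exact hs.sum_le_tsum _ fun i _ => hα i

theorem lintegral_exp_sum_le (hα : ∀ j, 0 ≤ α j) (hs : Summable α) (hαa : ∀ j, α j ≤ a)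
    (hi : Integrable (fun y => |y| * Real.exp (a * |y|)) γ) (s : Finset ℕ) :
    ∫⁻ y, ENNReal.ofReal (Real.exp (∑ i ∈ s, α i * |y i|))
        ∂(Measure.infinitePi fun _ : ℕ => γ) ≤
      ENNReal.ofReal (Real.exp ((∑' i, α i) * ∫ y, |y| * Real.exp (a * |y|) ∂γ)) := by
  simp_rw [Real.exp_sum, ENNReal.ofReal_prod_of_nonneg (fun _ _ => (Real.exp_pos _).le)]
  rw [lintegral_infinitePi_prod γ s
    (f := fun i x => ENNReal.ofReal (Real.exp (α i * |x|))) (fun i => by fun_prop)]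
  exact prod_lintegral_exp_mul_abs_le hα hs hαa hi s

/-- By independence the factor `y j ^ 2` affects only the last coordinate; raising its exponent to
`a` makes the bound free of `j`. -/
theorem lintegral_sq_mul_exp_sum_le (hα : ∀ j, 0 ≤ α j) (hs : Summable α) (hαa : ∀ j, α j ≤ a)
    (hi : Integrable (fun y => |y| * Real.exp (a * |y|)) γ)
    (hi2 : Integrable (fun y => y ^ 2 * Real.exp (a * |y|)) γ) (j : ℕ) :
    ∫⁻ y, ENNReal.ofReal (y j ^ 2 * Real.exp (∑ i ∈ Finset.range (j + 1), α i * |y i|))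
        ∂(Measure.infinitePi fun _ : ℕ => γ) ≤
      ENNReal.ofReal (Real.exp ((∑' i, α i) * ∫ y, |y| * Real.exp (a * |y|) ∂γ) *
        ∫ y, y ^ 2 * Real.exp (a * |y|) ∂γ) := by
  have h1 : ∀ y : ℕ → ℝ,
      ENNReal.ofReal (y j ^ 2 * Real.exp (∑ i ∈ Finset.range (j + 1), α i * |y i|)) =
      ∏ i ∈ Finset.range (j + 1), (fun (i : ℕ) (x : ℝ) =>
        ENNReal.ofReal ((if i = j then x ^ 2 else 1) * Real.exp (α i * |x|))) i (y i) := fun y => by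
    rw [← ENNReal.ofReal_prod_of_nonneg (fun i _ => by split_ifs <;> positivity),
      Finset.prod_mul_distrib, Finset.prod_ite_eq' (Finset.range (j + 1)) j, Real.exp_sum]
    simp
  refine ((lintegral_congr h1).trans (lintegral_infinitePi_prod γ (Finset.range (j + 1))
    (f := fun i x => ENNReal.ofReal ((if i = j then x ^ 2 else 1) * Real.exp (α i * |x|)))
    (fun i => by split_ifs <;> fun_prop))).trans_le ?_
  rw [Finset.prod_range_succ, ENNReal.ofReal_mul (Real.exp_pos _).le]
  gcongr
  · refine le_trans (le_of_eq (Finset.prod_congr rfl fun i hi => ?_))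
      (prod_lintegral_exp_mul_abs_le hα hs hαa hi (Finset.range j))
    simp [(Finset.mem_range.1 hi).ne]
  · rw [ofReal_integral_eq_lintegral_ofReal hi2
      (Eventually.of_forall fun y => by simp only [Pi.zero_apply]; positivity)]
    simp only [if_true]
    gcongr
    exact hαa j

/-- Monotone convergence gives the supremum of the partial exponentials a finite integral, which
yields both claims at once. -/
theorem ae_mem_USet_and_integrable_exp_tsum (hα : ∀ j, 0 ≤ α j) (hs : Summable α)
    (hαa : ∀ j, α j ≤ a) (hi : Integrable (fun y => |y| * Real.exp (a * |y|)) γ) :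
    (∀ᵐ y ∂(Measure.infinitePi fun _ : ℕ => γ), y ∈ USet α) ∧
      Integrable (fun y : ℕ → ℝ => Real.exp (∑' i, α i * |y i|))
        (Measure.infinitePi fun _ : ℕ => γ) := by
  set μ := Measure.infinitePi fun _ : ℕ => γ
  set F : ℕ → (ℕ → ℝ) → ENNReal := fun n y =>
    ENNReal.ofReal (Real.exp (∑ i ∈ Finset.range n, α i * |y i|)) with hF
  have hFm : ∀ n, Measurable (F n) := fun n => by fun_prop
  have hmono : Monotone F := by
    intro m n hmn y
    simp only [hF]
    gcongr
    exact fun i _ _ => mul_nonneg (hα i) (abs_nonneg _)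
  have hlt : ∫⁻ y, ⨆ n, F n y ∂μ < ⊤ := by
    rw [lintegral_iSup hFm hmono]
    exact (iSup_le fun n => lintegral_exp_sum_le hα hs hαa hi (Finset.range n)).trans_lt
      ENNReal.ofReal_lt_top
  have hU : ∀ᵐ y ∂μ, y ∈ USet α := by
    filter_upwards [ae_lt_top (Measurable.iSup hFm) hlt.ne] with y hy
    refine summable_of_sum_range_le (c := (⨆ n, F n y).toReal)
      (fun i => mul_nonneg (hα i) (abs_nonneg _)) fun n => ?_
    have h1 : F n y ≤ ⨆ n, F n y := le_iSup (fun n => F n y) n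
    have h2 := (ENNReal.ofReal_le_iff_le_toReal hy.ne).1 h1
    linarith [Real.add_one_le_exp (∑ i ∈ Finset.range n, α i * |y i|)]
  have hlim : ∀ᵐ y ∂μ, Tendsto (fun n => Real.exp (∑ i ∈ Finset.range n, α i * |y i|)) atTop
      (𝓝 (Real.exp (∑' i, α i * |y i|))) := by
    filter_upwards [hU] with y hy
    exact (Real.continuous_exp.tendsto _).comp hy.hasSum.tendsto_sum_nat
  refine ⟨hU, aestronglyMeasurable_of_tendsto_ae atTop
    (fun n => Measurable.aestronglyMeasurable (by fun_prop)) hlim, ?_⟩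
  rw [hasFiniteIntegral_iff_ofReal (Eventually.of_forall fun y => (Real.exp_pos _).le)]
  refine (lintegral_mono_ae ?_).trans_lt hlt
  filter_upwards [hlim] with y hy
  refine le_of_tendsto ((ENNReal.continuous_ofReal.tendsto _).comp hy)
    (Eventually.of_forall fun n => ?_)
  exact le_iSup (fun n => F n y) n

end Product

/-! ### Second differences and partial derivatives -/

/-- The mean value inequality is used twice: on `deriv h` between `-u` and `u`, then on `u ↦ h u + h
(-u)` between `0` and `t`. -/
theorem norm_second_difference_le {X : Type*} [NormedAddCommGroup X] [NormedSpace ℝ X]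
    {h : ℝ → X} (hh : ContDiff ℝ 2 h) {M t : ℝ}
    (hM : ∀ u, |u| ≤ |t| → ‖deriv (deriv h) u‖ ≤ M) :
    ‖h t + h (-t) - (2 : ℝ) • h 0‖ ≤ 2 * M * t ^ 2 := by
  have hd : Differentiable ℝ h := hh.differentiable (by norm_num)
  have hd' : Differentiable ℝ (deriv h) :=
    ((contDiff_succ_iff_deriv (n := 1)).1 hh).2.2.differentiable (by norm_num)
  have hM0 : 0 ≤ M := (norm_nonneg _).trans (hM 0 (by simp))
  have hc : Convex ℝ (Set.Icc (-|t|) |t|) := convex_Icc _ _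
  have h1 : ∀ u ∈ Set.Icc (-|t|) |t|, ‖deriv h u - deriv h (-u)‖ ≤ 2 * M * |t| := fun u hu => by
    have h2 := hc.norm_image_sub_le_of_norm_deriv_le (f := deriv h) (C := M)
      (fun x _ => hd' x) (fun x hx => hM x (abs_le.2 hx))
      (x := -u) (y := u) ⟨by linarith [hu.2], by linarith [hu.1]⟩ hu
    refine h2.trans ?_
    rw [show u - -u = 2 * u by ring, norm_mul, Real.norm_eq_abs u, Real.norm_two]
    nlinarith [abs_le.2 hu]
  have h3 : ∀ u, HasDerivAt (fun u => h u + h (-u)) (deriv h u - deriv h (-u)) u := fun u => by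
    have h4 : HasDerivAt (fun u => h (-u)) ((-1 : ℝ) • deriv h (-u)) u :=
      (hd (-u)).hasDerivAt.scomp u (hasDerivAt_neg u)
    rw [neg_one_smul] at h4
    rw [sub_eq_add_neg]
    exact (hd u).hasDerivAt.add h4
  have h5 := hc.norm_image_sub_le_of_norm_hasDerivWithin_le
    (fun u _ => (h3 u).hasDerivWithinAt) h1
    (x := 0) (y := t) ⟨by simp, by simp⟩ ⟨neg_abs_le t, le_abs_self t⟩
  simp only [neg_zero, sub_zero, Real.norm_eq_abs] at h5
  rw [two_smul]
  calc _ ≤ _ := h5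
    _ = 2 * M * |t| ^ 2 := by ring
    _ = _ := by rw [sq_abs]

section Slices

variable {X : Type*} [NormedAddCommGroup X] [NormedSpace ℝ X]

theorem mixedPartial_zero (g : (ℕ → ℝ) → X) : mixedPartial 0 g = g := by
  simp [mixedPartial]

theorem mixedPartial_single_two (j : ℕ) (g : (ℕ → ℝ) → X) (z : ℕ → ℝ) (u : ℝ) :
    mixedPartial (Finsupp.single j 2) g (Function.update z j u) =
      deriv (deriv fun t => g (Function.update z j t)) u := by
  have h : (Finsupp.toMultiset (Finsupp.single j 2)).sort (· ≤ ·) = List.replicate 2 j :=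
    List.eq_replicate_iff.2 ⟨by simp, fun i hi => by simpa using hi⟩
  rw [mixedPartial, h]
  simp [List.replicate, partialDeriv]

/-- Thanks to this, the bounds on `g` and its derivatives hold at every truncated point, not just
almost everywhere. -/
theorem truncSeq_mem_USet (α : ℕ → ℝ) (n : ℕ) (y : ℕ → ℝ) : truncSeq n y ∈ USet α := by
  refine summable_of_ne_finset_zero (s := Finset.range n) fun i hi => ?_
  simp [truncSeq, Finset.mem_range.not.1 hi]

theorem update_truncSeq (j : ℕ) (y : ℕ → ℝ) (u : ℝ) :
    Function.update (truncSeq j y) j u = truncSeq (j + 1) (Function.update y j u) := by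
  ext i
  rcases lt_trichotomy i j with h | rfl | h
  · simp [truncSeq, h, h.ne, h.le]
  · simp [truncSeq]
  · simp [truncSeq, h.ne', h.not_ge, h.not_gt]

theorem update_truncSeq_zero (j : ℕ) (y : ℕ → ℝ) :
    Function.update (truncSeq j y) j 0 = truncSeq j y := by
  rw [Function.update_eq_self_iff]
  simp [truncSeq]

theorem tprod_exp_truncSeq (α : ℕ → ℝ) (n : ℕ) (y : ℕ → ℝ) :
    ∏' j, Real.exp (α j * |truncSeq n y j|) =
      Real.exp (∑ i ∈ Finset.range n, α i * |y i|) := by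
  rw [tprod_eq_prod (s := Finset.range n), Real.exp_sum]
  · exact Finset.prod_congr rfl fun i hi => by simp [truncSeq, Finset.mem_range.1 hi]
  · intro i hi
    simp [truncSeq, Finset.mem_range.not.1 hi]

theorem tprod_exp_of_mem_USet {α y : ℕ → ℝ} (hy : y ∈ USet α) :
    ∏' j, Real.exp (α j * |y j|) = Real.exp (∑' j, α j * |y j|) :=
  (Summable.hasSum hy).rexp.tprod_eq

theorem ContDiffFinitary.continuous_comp_truncSeq {n : ℕ} {g : (ℕ → ℝ) → X} {α : ℕ → ℝ}
    (h : ContDiffFinitary n g (USet α)) (s : ℕ) : Continuous fun y => g (truncSeq s y) := by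
  have h0 : (fun _ => 0 : ℕ → ℝ) ∈ USet α := by
    simp [USet, summable_zero]
  refine ((h _ h0 (Finset.range s)).continuous.comp
    (f := fun (y : ℕ → ℝ) (i : Finset.range s) => y i) (by fun_prop)).congr fun y => ?_
  simp [coordSlice]
  rfl

theorem ContDiffFinitary.contDiff_update {n : ℕ} {g : (ℕ → ℝ) → X} {U : Set (ℕ → ℝ)}
    (h : ContDiffFinitary n g U) {z : ℕ → ℝ} (hz : z ∈ U) (j : ℕ) :
    ContDiff ℝ n fun t => g (Function.update z j t) := by
  have h1 := (h z hz {j}).comp (f := fun (t : ℝ) (_ : ({j} : Finset ℕ)) => t) (by fun_prop)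
  convert h1 using 1
  ext t
  simp only [coordSlice, Function.comp_apply]
  congr 1
  ext i
  by_cases hi : i = j <;> simp [hi]

end Slices

/-! ### Telescoping over the coordinates -/

theorem measurePreserving_reflect {γ : Measure ℝ} [IsProbabilityMeasure γ]
    (hγ : γ.map (fun y => -y) = γ) (j : ℕ) :
    MeasurePreserving (fun y : ℕ → ℝ => Function.update y j (-y j))
      (Measure.infinitePi fun _ : ℕ => γ) (Measure.infinitePi fun _ : ℕ => γ) := by
  have hf : ∀ i : ℕ, Measurable fun x : ℝ => if i = j then -x else x := fun i => by
    split_ifs <;> fun_prop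
  have h1 : (fun y : ℕ → ℝ => Function.update y j (-y j)) =
      fun y i => (fun x : ℝ => if i = j then -x else x) (y i) := by
    ext y i
    by_cases hi : i = j
    · subst hi; simp
    · simp [hi]
  rw [h1]
  refine ⟨measurable_pi_lambda _ fun i => (hf i).comp (measurable_pi_apply i), ?_⟩
  rw [Measure.infinitePi_map_pi _ hf]
  congr 1
  ext1 i
  by_cases hi : i = j
  · simpa [hi] using hγ
  · simp [hi]

section Step

variable {X : Type*} [NormedAddCommGroup X] [NormedSpace ℝ X] {α : ℕ → ℝ} {g : (ℕ → ℝ) → X}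
  {D : ℝ} {c : ℕ → ℝ}

theorem norm_truncSeq_reflect_le (hα : ∀ j, 0 ≤ α j)
    (hdiff : ContDiffFinitary 2 g (USet α)) (hc : ∀ j, 0 ≤ c j)
    (h2 : ∀ y ∈ USet α, ∀ j, ‖mixedPartial (Finsupp.single j 2) g y‖ ≤
      c j * ∏' i, Real.exp (α i * |y i|)) (j : ℕ) (y : ℕ → ℝ) :
    ‖g (truncSeq (j + 1) y) + g (truncSeq (j + 1) (Function.update y j (-y j))) -
      (2 : ℝ) • g (truncSeq j y)‖ ≤
      2 * c j * (y j ^ 2 * Real.exp (∑ i ∈ Finset.range (j + 1), α i * |y i|)) := by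
  -- The three values of `g` are those of a single slice in variable `j` at `y j`, `-y j` and `0`.
  have hz := truncSeq_mem_USet α j y
  have hM : ∀ u, |u| ≤ |y j| →
      ‖deriv (deriv fun t => g (Function.update (truncSeq j y) j t)) u‖ ≤
        c j * Real.exp (∑ i ∈ Finset.range (j + 1), α i * |y i|) := fun u hu => by
    rw [← mixedPartial_single_two, update_truncSeq]
    refine (h2 _ (truncSeq_mem_USet α _ _) j).trans ?_
    rw [tprod_exp_truncSeq]
    refine mul_le_mul_of_nonneg_left (Real.exp_le_exp.2 (Finset.sum_le_sum fun i _ =>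
      mul_le_mul_of_nonneg_left ?_ (hα i))) (hc j)
    · by_cases hij : i = j
      · subst hij; simpa using hu
      · simp [hij]
  have h := norm_second_difference_le (hdiff.contDiff_update hz j) hM
  simp only [update_truncSeq_zero] at h
  simp only [update_truncSeq, Function.update_eq_self] at h
  exact h.trans_eq (by ring)

theorem norm_integral_truncSeq_succ_sub_le [CompleteSpace X] {γ : Measure ℝ}
    [IsProbabilityMeasure γ] (hγ : γ.map (fun y => -y) = γ) (hα : ∀ j, 0 ≤ α j)
    (hdiff : ContDiffFinitary 2 g (USet α)) (hc : ∀ j, 0 ≤ c j)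
    (h2 : ∀ y ∈ USet α, ∀ j, ‖mixedPartial (Finsupp.single j 2) g y‖ ≤
      c j * ∏' i, Real.exp (α i * |y i|))
    (hint : ∀ n, Integrable (fun y => g (truncSeq n y)) (Measure.infinitePi fun _ : ℕ => γ))
    (hD : 0 ≤ D) (j : ℕ)
    (hj : ∫⁻ y, ENNReal.ofReal (y j ^ 2 * Real.exp (∑ i ∈ Finset.range (j + 1), α i * |y i|))
      ∂(Measure.infinitePi fun _ : ℕ => γ) ≤ ENNReal.ofReal D) :
    ‖∫ y, (g (truncSeq (j + 1) y) - g (truncSeq j y)) ∂(Measure.infinitePi fun _ : ℕ => γ)‖ ≤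
      D * c j := by
  set μ := Measure.infinitePi fun _ : ℕ => γ
  have hR := measurePreserving_reflect hγ j
  have hintR : Integrable
      (fun y => g (truncSeq (j + 1) (Function.update y j (-y j)))) μ :=
    hR.integrable_comp_of_integrable (hint (j + 1))
  have hR1 : ∫ y, g (truncSeq (j + 1) (Function.update y j (-y j))) ∂μ =
      ∫ y, g (truncSeq (j + 1) y) ∂μ := by
    have h := integral_map hR.measurable.aemeasurable (f := fun y => g (truncSeq (j + 1) y))
      (by rw [hR.map_eq]; exact (hint (j + 1)).aestronglyMeasurable)
    rw [hR.map_eq] at h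
    exact h.symm
  have hb0 : ∀ y : ℕ → ℝ,
      0 ≤ y j ^ 2 * Real.exp (∑ i ∈ Finset.range (j + 1), α i * |y i|) := fun y => by positivity
  have hbint : Integrable
      (fun y : ℕ → ℝ => y j ^ 2 * Real.exp (∑ i ∈ Finset.range (j + 1), α i * |y i|)) μ := by
    refine ⟨Measurable.aestronglyMeasurable (by fun_prop), ?_⟩
    rw [hasFiniteIntegral_iff_ofReal (Eventually.of_forall hb0)]
    exact hj.trans_lt ENNReal.ofReal_lt_top
  have hbD : ∫ y, y j ^ 2 * Real.exp (∑ i ∈ Finset.range (j + 1), α i * |y i|) ∂μ ≤ D := by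
    rw [integral_eq_lintegral_of_nonneg_ae (Eventually.of_forall hb0) hbint.aestronglyMeasurable]
    exact ENNReal.toReal_le_of_le_ofReal hD hj
  have hkey := norm_integral_le_of_norm_le (hbint.const_mul (2 * c j))
    (Eventually.of_forall (norm_truncSeq_reflect_le hα hdiff hc h2 j))
  rw [integral_sub (f := fun y => g (truncSeq (j + 1) y) +
      g (truncSeq (j + 1) (Function.update y j (-y j)))) (g := fun y => (2 : ℝ) • g (truncSeq j y))
      ((hint _).add hintR) ((hint j).smul _), integral_add (hint _) hintR, integral_smul,
    hR1, ← two_smul ℝ, ← smul_sub, norm_smul, integral_const_mul, Real.norm_two]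
    at hkey
  rw [integral_sub (hint _) (hint _)]
  nlinarith [mul_le_mul_of_nonneg_left hbD (hc j)]

end Step

/-! ### Tail sums of monotone summable sequences -/

/-- Stechkin's argument: monotonicity gives `s * b j ^ p ≤ S` for `j ≥ s`, and `b j ^ 2` splits as
`b j ^ p` times a power of `b j ^ p`. -/
theorem sum_Ico_sq_le_of_antitone {b : ℕ → ℝ} {p : ℝ} (hp0 : 0 < p) (hp1 : p < 1)
    (hb : ∀ j, 0 ≤ b j) (hanti : Antitone b) (hs : Summable fun j => b j ^ p)
    {s : ℕ} (hs1 : 1 ≤ s) (N : ℕ) :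
    ∑ j ∈ Finset.Ico s N, b j ^ 2 ≤ (∑' j, b j ^ p) ^ (2 / p) * (s : ℝ) ^ (-2 / p + 1) := by
  set S := ∑' j, b j ^ p
  have hs0 : (0 : ℝ) < s := by exact_mod_cast hs1
  have hnn : ∀ j, 0 ≤ b j ^ p := fun j => Real.rpow_nonneg (hb j) p
  have hS : 0 ≤ S := tsum_nonneg hnn
  have h1 : ∀ j, s ≤ j → b j ^ p ≤ S / s := fun j hj => by
    rw [le_div_iff₀ hs0]
    calc b j ^ p * s = ∑ i ∈ Finset.range s, b j ^ p := by simp [mul_comm]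
      _ ≤ ∑ i ∈ Finset.range s, b i ^ p := Finset.sum_le_sum fun i hi =>
          Real.rpow_le_rpow (hb j) (hanti ((Finset.mem_range.1 hi).le.trans hj)) hp0.le
      _ ≤ S := hs.sum_le_tsum _ fun i _ => hnn i
  have hp2 : 0 < 2 / p - 1 := by
    rw [sub_pos, lt_div_iff₀ hp0]; linarith
  have h2 : ∀ j, s ≤ j → b j ^ 2 ≤ b j ^ p * (S / s) ^ (2 / p - 1) := fun j hj => by
    calc b j ^ 2 = b j ^ p * (b j ^ p) ^ (2 / p - 1) := by
          rw [← Real.rpow_mul (hb j), ← Real.rpow_add_of_nonneg (hb j) hp0.le (by positivity),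
            show p + p * (2 / p - 1) = 2 by field_simp; ring, Real.rpow_two]
      _ ≤ _ := by
          have := h1 j hj
          have := hnn j
          gcongr
  calc ∑ j ∈ Finset.Ico s N, b j ^ 2
      ≤ ∑ j ∈ Finset.Ico s N, b j ^ p * (S / s) ^ (2 / p - 1) :=
        Finset.sum_le_sum fun j hj => h2 j (Finset.mem_Ico.1 hj).1
    _ ≤ S * (S / s) ^ (2 / p - 1) := by
        rw [← Finset.sum_mul]
        gcongr
        exact hs.sum_le_tsum _ fun i _ => hnn i
    _ = _ := by
        rw [Real.div_rpow hS hs0.le, mul_div_assoc', show -2 / p + 1 = -(2 / p - 1) by ring,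
          Real.rpow_neg hs0.le, div_eq_mul_inv]
        congr 1
        nth_rewrite 1 [← Real.rpow_one S]
        rw [← Real.rpow_add_of_nonneg hS one_pos.le hp2.le]
        ring_nf

/-- Only finitely many `α j` exceed `1 / 2`, so for `β = 1` their supremum stays below `1`. The gap
between `a` and `a'` absorbs the factors `|y|` and `y ^ 2`. -/
theorem exists_exponent_bound_of_summable {α : ℕ → ℝ} (hs : Summable α) {β : ℝ}
    (h : β = 1 → ∀ j, α j < 1) :
    ∃ a a' : ℝ, (∀ j, α j ≤ a) ∧ a < a' ∧ (β = 1 → a' < 1) := by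
  obtain ⟨N, hN⟩ := eventually_atTop.1
    (hs.tendsto_atTop_zero.eventually_le_const (by norm_num : (0 : ℝ) < 1 / 2))
  set F : Finset ℝ := ((Finset.range N).image α) ∪ {1 / 2} with hF
  have hne : F.Nonempty := ⟨1 / 2, by simp [hF]⟩
  have ha : ∀ j, α j ≤ F.max' hne := fun j => by
    rcases lt_or_ge j N with hj | hj
    · exact F.le_max' _ (Finset.mem_union_left _
        (Finset.mem_image_of_mem α (Finset.mem_range.2 hj)))
    · exact (hN j hj).trans (F.le_max' _ (by simp [hF]))
  by_cases hβ : β = 1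
  · have h1 : F.max' hne < 1 := by
      rw [Finset.max'_lt_iff]
      intro x hx
      simp only [hF, Finset.mem_union, Finset.mem_image, Finset.mem_singleton] at hx
      rcases hx with ⟨i, _, rfl⟩ | rfl
      · exact h hβ i
      · norm_num
    obtain ⟨a', h2, h3⟩ := exists_between h1
    exact ⟨_, a', ha, h2, fun _ => h3⟩
  · exact ⟨_, _, ha, lt_add_one _, fun h => absurd h hβ⟩

/-! ### Assembly of the truncation bound -/

/-- Dimension truncation for a product of copies of a symmetric measure with exponential moments.
The error is telescoped over the coordinates; by symmetry each increment has the expectation of a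
second difference in one variable, so that pure second derivatives suffice. -/
theorem exists_dimension_truncation_bound {X : Type*} [NormedAddCommGroup X] [NormedSpace ℝ X]
    [CompleteSpace X] {γ : Measure ℝ} [IsProbabilityMeasure γ]
    (hγ : γ.map (fun y => -y) = γ) {α : ℕ → ℝ} (hα : ∀ j, 0 ≤ α j) (hs : Summable α) {a : ℝ}
    (hαa : ∀ j, α j ≤ a) (hi1 : Integrable (fun y => |y| * Real.exp (a * |y|)) γ)
    (hi2 : Integrable (fun y => y ^ 2 * Real.exp (a * |y|)) γ) {g : (ℕ → ℝ) → X}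
    (hA1 : ∀ᵐ y ∂(Measure.infinitePi fun _ : ℕ => γ), y ∈ USet α →
      Tendsto (fun s : ℕ => ‖g y - g (truncSeq s y)‖) atTop (𝓝 0))
    {p : ℝ} (hp0 : 0 < p) (hp1 : p < 1) {b : ℕ → ℝ} (hb : ∀ j, 0 ≤ b j) (hanti : Antitone b)
    (hbs : Summable fun j => b j ^ p) (hdiff : ContDiffFinitary 2 g (USet α)) {Θ₀ Θ₂ : ℝ}
    (hΘ₂ : 0 ≤ Θ₂) (h0 : ∀ y ∈ USet α, ‖g y‖ ≤ Θ₀ * ∏' i, Real.exp (α i * |y i|))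
    (h2 : ∀ y ∈ USet α, ∀ j, ‖mixedPartial (Finsupp.single j 2) g y‖ ≤
      Θ₂ * b j ^ 2 * ∏' i, Real.exp (α i * |y i|)) :
    ∃ C : ℝ, 0 < C ∧ ∀ s : ℕ, 1 ≤ s →
      Integrable (fun y => g y - g (truncSeq s y)) (Measure.infinitePi fun _ : ℕ => γ) ∧
      ‖∫ y, (g y - g (truncSeq s y)) ∂(Measure.infinitePi fun _ : ℕ => γ)‖ ≤
        C * (s : ℝ) ^ (-2 / p + 1) := by
  obtain ⟨hU, hE⟩ := ae_mem_USet_and_integrable_exp_tsum (γ := γ) hα hs hαa hi1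
  have hD := lintegral_sq_mul_exp_sum_le hα hs hαa hi1 hi2
  set μ := Measure.infinitePi fun _ : ℕ => γ
  set D := Real.exp ((∑' i, α i) * ∫ y, |y| * Real.exp (a * |y|) ∂γ) *
        ∫ y, y ^ 2 * Real.exp (a * |y|) ∂γ
  have hD0 : 0 ≤ D := mul_nonneg (Real.exp_pos _).le (integral_nonneg fun y => by positivity)
  have hΘ₀ : 0 ≤ Θ₀ := by
    have := (norm_nonneg _).trans (h0 _ (truncSeq_mem_USet α 0 0))
    rw [tprod_exp_truncSeq] at this
    simpa using this
  have hgm : ∀ n, AEStronglyMeasurable (fun y => g (truncSeq n y)) μ := fun n =>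
    (hdiff.continuous_comp_truncSeq n).aestronglyMeasurable
  have hgb : ∀ n, ∀ᵐ y ∂μ, ‖g (truncSeq n y)‖ ≤ Θ₀ * Real.exp (∑' i, α i * |y i|) := fun n => by
    filter_upwards [hU] with y hy
    refine (h0 _ (truncSeq_mem_USet α n y)).trans ?_
    rw [tprod_exp_truncSeq]
    gcongr
    exact Summable.sum_le_tsum _ (fun i _ => mul_nonneg (hα i) (abs_nonneg _)) hy
  have hlim : ∀ᵐ y ∂μ, Tendsto (fun n => g (truncSeq n y)) atTop (𝓝 (g y)) := by
    filter_upwards [hU, hA1] with y hy h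
    rw [tendsto_iff_norm_sub_tendsto_zero]
    simpa only [norm_sub_rev] using h hy
  have hgint : ∀ n, Integrable (fun y => g (truncSeq n y)) μ := fun n =>
    (hE.const_mul Θ₀).mono' (hgm n) (hgb n)
  -- Measurability of `g` comes from its being the a.e. limit of its continuous truncations.
  have hg : Integrable g μ := by
    refine (hE.const_mul Θ₀).mono' (aestronglyMeasurable_of_tendsto_ae atTop hgm hlim) ?_
    filter_upwards [hU] with y hy
    rw [← tprod_exp_of_mem_USet hy]
    exact h0 y hy
  have htend : Tendsto (fun n => ∫ y, g (truncSeq n y) ∂μ) atTop (𝓝 (∫ y, g y ∂μ)) :=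
    tendsto_integral_of_dominated_convergence _ hgm (hE.const_mul Θ₀) hgb hlim
  have hstep := fun j => norm_integral_truncSeq_succ_sub_le hγ hα hdiff
    (fun j => mul_nonneg hΘ₂ (sq_nonneg (b j))) h2 hgint hD0 j (hD j)
  -- The `+ 1` serves only to make the constant strictly positive.
  refine ⟨D * Θ₂ * (∑' j, b j ^ p) ^ (2 / p) + 1, ?_, fun s hs1 => ⟨hg.sub (hgint s), ?_⟩⟩
  · have : 0 ≤ ∑' j, b j ^ p := tsum_nonneg fun j => Real.rpow_nonneg (hb j) p
    positivity
  rw [integral_sub hg (hgint s)]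
  refine le_of_tendsto (htend.sub_const _).norm ?_
  filter_upwards [eventually_ge_atTop s] with N hN
  have htel : ∫ y, g (truncSeq N y) ∂μ - ∫ y, g (truncSeq s y) ∂μ =
      ∑ j ∈ Finset.Ico s N, ∫ y, (g (truncSeq (j + 1) y) - g (truncSeq j y)) ∂μ := by
    rw [← Finset.sum_Ico_sub (fun n => ∫ y, g (truncSeq n y) ∂μ) hN]
    exact Finset.sum_congr rfl fun j _ => (integral_sub (hgint _) (hgint _)).symm
  rw [htel]
  calc _ ≤ ∑ j ∈ Finset.Ico s N, D * (Θ₂ * b j ^ 2) :=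
        (norm_sum_le _ _).trans (Finset.sum_le_sum fun j _ => hstep j)
    _ = D * Θ₂ * ∑ j ∈ Finset.Ico s N, b j ^ 2 := by
        rw [Finset.mul_sum]
        exact Finset.sum_congr rfl fun j _ => by ring
    _ ≤ D * Θ₂ * ((∑' j, b j ^ p) ^ (2 / p) * (s : ℝ) ^ (-2 / p + 1)) := by
        gcongr
        exact sum_Ico_sq_le_of_antitone hp0 hp1 hb hanti hbs hs1 N
    _ ≤ _ := by
        have : 0 ≤ (s : ℝ) ^ (-2 / p + 1) := by positivity
        linarith

/-- Dimension truncation error for `β`-Gaussian integrals. The map `g` matters only on `U_α`, a set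
of full measure; its values elsewhere are arbitrary. -/
theorem theorem1 {X : Type*} [NormedAddCommGroup X] [NormedSpace ℝ X] [CompleteSpace X]
    [TopologicalSpace.SeparableSpace X]
    (β : ℝ) (hβ : 1 ≤ β)
    (α : ℕ → ℝ) (hα_nonneg : ∀ j, 0 ≤ α j) (hα_sum : Summable α)
    (hα_lt_one : β = 1 → ∀ j, α j < 1)
    (g : (ℕ → ℝ) → X)
    (hA1 : ∀ᵐ y ∂(betaGaussianProduct β), y ∈ USet α →
      Tendsto (fun s : ℕ => ‖g y - g (truncSeq s y)‖) atTop (𝓝 0))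
    (p : ℝ) (hp0 : 0 < p) (hp1 : p < 1)
    (Θ : ℕ → ℝ) (hΘ : ∀ n, 0 ≤ Θ n)
    (b : ℕ → ℝ) (hb_nonneg : ∀ j, 0 ≤ b j) (hb_anti : Antitone b)
    (hb_sum : Summable fun j => b j ^ p)
    (k : ℕ) (hk : k = ⌈1 / (1 - p)⌉₊)
    (hdiff : ContDiffFinitary (k + 1) g (USet α))
    (hA2 : ∀ y ∈ USet α, ∀ ν : ℕ →₀ ℕ, ν.degree ≤ k + 1 →
      ‖mixedPartial ν g y‖ ≤
        Θ ν.degree * (ν.prod fun j m => b j ^ m) * ∏' j, Real.exp (α j * |y j|)) :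
    ∃ C : ℝ, 0 < C ∧ ∀ s : ℕ, 1 ≤ s →
      Integrable (fun y => g y - g (truncSeq s y)) (betaGaussianProduct β) ∧
      ‖∫ y, (g y - g (truncSeq s y)) ∂(betaGaussianProduct β)‖ ≤ C * (s : ℝ) ^ (-2 / p + 1) ∧
      ∀ G : X →L[ℝ] ℝ,
        |∫ y, G (g y - g (truncSeq s y)) ∂(betaGaussianProduct β)| ≤
          C * ‖G‖ * (s : ℝ) ^ (-2 / p + 1) := by
  have hβ0 : 0 < β := by linarith
  have := isProbabilityMeasure_betaGaussian hβ0
  obtain ⟨a, a', hαa, haa', ha'⟩ := exists_exponent_bound_of_summable hα_sum hα_lt_one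
  have hexp := integrable_exp_mul_abs_betaGaussian hβ ha'
  -- This makes second-order derivatives available, since `2 ≤ k + 1`.
  have hk1 : 1 ≤ k := by
    rw [hk, Nat.one_le_ceil_iff]
    exact one_div_pos.2 (sub_pos.2 hp1)
  have hdiff2 : ContDiffFinitary 2 g (USet α) := fun y hy J =>
    (hdiff y hy J).of_le (by exact_mod_cast Nat.succ_le_succ hk1)
  obtain ⟨C, hC, hmain⟩ := exists_dimension_truncation_bound (Θ₀ := Θ 0) (Θ₂ := Θ 2)
    (map_neg_betaGaussian β) hα_nonneg hα_sum hαa (integrable_abs_mul_exp_mul_abs haa' hexp)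
    (integrable_sq_mul_exp_mul_abs haa' hexp) hA1 hp0 hp1 hb_nonneg hb_anti hb_sum hdiff2 (hΘ 2)
    (fun y hy => by simpa [mixedPartial_zero] using hA2 y hy 0 (by simp))
    (fun y hy j => by
      simpa [Finsupp.prod_single_index] using hA2 y hy (Finsupp.single j 2) (by simpa using hk1))
  refine ⟨C, hC, fun s hs => ⟨(hmain s hs).1, (hmain s hs).2, fun G => ?_⟩⟩
  have hint : Integrable (fun y => g y - g (truncSeq s y)) (betaGaussianProduct β) :=
    (hmain s hs).1
  rw [G.integral_comp_comm hint, ← Real.norm_eq_abs]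
  calc _ ≤ ‖G‖ * ‖∫ y, (g y - g (truncSeq s y)) ∂(betaGaussianProduct β)‖ := G.le_opNorm _
    _ ≤ ‖G‖ * (C * (s : ℝ) ^ (-2 / p + 1)) := by
        gcongr
        exact (hmain s hs).2
    _ = _ := by ring
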